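/- Notation. For a smooth surjection $\pi\colon X\to M$ admitting smooth local sections, $X^{[p]}$ is the $p$-fold fibre product over $M$. A bundle gerbe $(Q,Y,N)$ is a smooth surjection $\pi_Y\colon Y\to N$ admitting local sections, a principal $\mathbb C^\times$-bundle $Q\to Y^{[2]}$, and a smooth associative product $m_Q\colon Q_{(y_2,y_3)}\otimes Q_{(y_1,y_2)}\to Q_{(y_1,y_3)}$ of $\mathbb C^\times$-bundles, also written $v\cdot w$; $e(y)\in Q_{(y,y)}$ denotes its identity section. A bundle 2-gerbe $(Q,Y,X,M)$ consists of a smooth surjection $\pi\colon X\to M$ admitting local sections, a bundle gerbe $(Q,Y,X^{[2]})$, and the following data. (a) A bundle gerbe morphism over $X^{[3]}$: a smooth map $m\colon Y_{(x_2,x_3)}\times Y_{(x_1,x_2)}\to Y_{(x_1,x_3)}$ and a smooth map of $\mathbb C^\times$-bundles $\hat m\colon Q_{(y_{23},y_{23}')}\otimes Q_{(y_{12},y_{12}')}\to Q_{(m(y_{23},y_{12}),\,m(y_{23}',y_{12}'))}$ covering it and commuting with the products $m_Q$. (b) A smooth section $\hat a(y_{34},y_{23},y_{12})\in Q_{(m(m(y_{34},y_{23}),y_{12}),\;m(y_{34},m(y_{23},y_{12})))}$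 that descends to $X^{[4]}$, that is, for $u_{ij}\in Q_{(y_{ij},y_{ij}')}$, $$\hat m(u_{34}\otimes\hat m(u_{23}\otimes u_{12}))\cdot\hat a(y_{34},y_{23},y_{12})=\hat a(y_{34}',y_{23}',y_{12}')\cdot\hat m(\hat m(u_{34}\otimes u_{23})\otimes u_{12}),$$ and that satisfies the coherency condition $$\hat m(e(y_{45})\otimes\hat a(y_{34},y_{23},y_{12}))\cdot\hat a(y_{45},m(y_{34},y_{23}),y_{12})\cdot\hat m(\hat a(y_{45},y_{34},y_{23})\otimes e(y_{12}))=\hat a(y_{45},y_{34},m(y_{23},y_{12}))\cdot\hat a(m(y_{45},y_{34}),y_{23},y_{12}).$$ Proposition. Let $(Q,Y,X,M)$ be a bundle 2-gerbe, let $p\in M$ and $X_p=\pi^{-1}(p)$. (1) There is a map of sets $I\colon X_p\to Y$ with $I(x)\in Y_{(x,x)}$ for all $x\in X_p$. (2) For every such $I$ there are families of points $\mathrm{id}_L(y)\in Q_{(y,\,m(y,I(x_1)))}$ and $\mathrm{id}_R(y)\in Q_{(y,\,m(I(x_2),y))}$, for $y\in Y_{(x_1,x_2)}$ and $x_1,x_2\in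 X_p$, which are natural, i.e. for $u\in Q_{(y,y')}$ $$\hat m(u\otimes e(I(x_1)))\cdot\mathrm{id}_L(y)=\mathrm{id}_L(y')\cdot u,\qquad \hat m(e(I(x_2))\otimes u)\cdot\mathrm{id}_R(y)=\mathrm{id}_R(y')\cdot u,$$ and which satisfy, for all $x\in X_p$ and all $y\in Y_{(x_1,x_2)}$, $$\mathrm{id}_L(I(x))=\mathrm{id}_R(I(x)),$$ $$\hat a(I(x_2),I(x_2),y)\cdot\hat m(\mathrm{id}_L(I(x_2))\otimes e(y))=\hat m(e(I(x_2))\otimes\mathrm{id}_R(y)),$$ $$\hat a(y,I(x_1),I(x_1))\cdot\hat m(\mathrm{id}_L(y)\otimes e(I(x_1)))=\hat m(e(y)\otimes\mathrm{id}_R(I(x_1))).$$ (3) For every $I$, $\mathrm{id}_L$, $\mathrm{id}_R$ as in (1) and (2) the following is a bicategory $\mathcal Q_p$. Its objects are the points of $X_p$; the 1-arrows $x\to x'$ are the points of $Y_{(x,x')}$; the 2-arrows $y\Rightarrow y'$ are the points of $Q_{(y,y')}$, composed by $m_Q$, with identities $e(y)$; the composition functor $\mathrm{Hom}(x_2,x_3)\times\mathrm{Hom}(x_1,x_2)\to\mathrm{Hom}(x_1,x_3)$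 is $m$ on 1-arrows and $\hat m$ on 2-arrows; the associativity isomorphism $(y_{34}\circ y_{23})\circ y_{12}\Rightarrow y_{34}\circ(y_{23}\circ y_{12})$ is $\hat a(y_{34},y_{23},y_{12})$; the identity 1-arrow of $x$ is $I(x)$; and the identity isomorphisms $y\Rightarrow y\circ I(x_1)$ and $y\Rightarrow I(x_2)\circ y$ are $\mathrm{id}_L(y)$ and $\mathrm{id}_R(y)$. -/

import Mathlib

open scoped Manifold ContDiff
open CategoryTheory

universe u

/-- A smooth (Hausdorff) manifold without boundary, modelled on a real normed space. -/
structure SmoothManifold where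
  carrier : Type u
  E : Type u
  H : Type u
  [normedE : NormedAddCommGroup E]
  [spaceE : NormedSpace ℝ E]
  [topH : TopologicalSpace H]
  model : ModelWithCorners ℝ E H
  [boundaryless : model.Boundaryless]
  [top : TopologicalSpace carrier]
  [hausdorff : T2Space carrier]
  [charted : ChartedSpace H carrier]
  [isManifold : IsManifold model ∞ carrier]

namespace SmoothManifold

instance : CoeSort SmoothManifold.{u} (Type u) := ⟨SmoothManifold.carrier⟩

attribute [instance] normedE spaceE topH boundaryless top hausdorff charted isManifold

/-- The product of two manifolds. -/
@[reducible]
noncomputable def prod (A B : SmoothManifold.{u}) : SmoothManifold.{u} where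
  carrier := A.carrier × B.carrier
  E := A.E × B.E
  H := ModelProd A.H B.H
  model := A.model.prod B.model

/-- Smoothness of a map on a subset `S` of a manifold `A`. If `S` is a submanifold of `A`, for
instance a fibre product inside a product, then this is smoothness of the restriction to `S`; the
values of `f` outside `S` play no role. -/
def SmoothOn {A B : SmoothManifold.{u}} (f : A → B) (S : Set A) : Prop :=
  ContMDiffOn A.model B.model ∞ f S

/-- `p : A → B`, with image in `S ⊆ B`, is smooth, surjective onto `S`, and admits smooth local
sections over `S`. -/
structure IsSurjectionWithLocalSections {A B : SmoothManifold.{u}} (p : A → B) (S : Set B) :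
    Prop where
  smooth : SmoothOn p Set.univ
  range_eq : Set.range p = S
  local_sections : ∀ b ∈ S, ∃ U : Set B, IsOpen U ∧ b ∈ U ∧
    ∃ s : B → A, SmoothOn s (S ∩ U) ∧ ∀ c ∈ S ∩ U, p (s c) = c

end SmoothManifold

open SmoothManifold

/-- A smooth principal `ℂˣ`-bundle over a (sub)manifold `S` of `B`. As `ℂˣ` is commutative, the
action is written on the left. -/
structure CStarBundle (B : SmoothManifold.{u}) (S : Set B) where
  total : SmoothManifold.{u}
  proj : total → B
  [action : MulAction ℂˣ total]
  proj_smooth : SmoothOn proj Set.univ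
  proj_mem : ∀ q, proj q ∈ S
  action_smooth : ContMDiff (𝓘(ℝ, ℂ).prod total.model) total.model ∞
    (fun p : ℂˣ × total => p.1 • p.2)
  proj_smul : ∀ (z : ℂˣ) (q : total), proj (z • q) = proj q
  free : ∀ (z : ℂˣ) (q : total), z • q = q → z = 1
  transitive : ∀ q q' : total, proj q = proj q' → ∃ z : ℂˣ, q' = z • q
  /-- Local triviality: near each point of `S` there are a smooth local section `s` and a smooth
  function `t` such that `q ↦ (proj q, t q)` is inverse to `(b, z) ↦ z • s b`. -/
  locally_trivial : ∀ b ∈ S, ∃ U : Set B, IsOpen U ∧ b ∈ U ∧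
    ∃ (s : B → total) (t : total → ℂˣ),
      SmoothOn s (S ∩ U) ∧ (∀ c ∈ S ∩ U, proj (s c) = c) ∧
      ContMDiffOn total.model 𝓘(ℝ, ℂ) ∞ t (proj ⁻¹' U) ∧
      ∀ q, proj q ∈ U → q = t q • s (proj q)

attribute [instance] CStarBundle.action

/-- A bundle gerbe `(Q, Y, S)` over a (sub)manifold `S` of `B`. For `q` in the fibre
`Q_{(y₁, y₂)}` the points `y₁`, `y₂` are the two components of `Q.proj q`. -/
structure BundleGerbe (B : SmoothManifold.{u}) (S : Set B) where
  Y : SmoothManifold.{u}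
  proj : Y → B
  proj_surj : IsSurjectionWithLocalSections proj S
  /-- The `ℂˣ`-bundle `Q → Y^{[2]}`. -/
  Q : CStarBundle (Y.prod Y) {p | proj p.1 = proj p.2}
  /-- The bundle gerbe product `Q_{(y₂, y₃)} ⊗ Q_{(y₁, y₂)} → Q_{(y₁, y₃)}`, as a map defined on
  pairs and equivariant in each variable, which is the same as a map of `ℂˣ`-bundles on the
  contracted product. Values on non-composable pairs play no role. -/
  mul : Q.total → Q.total → Q.total
  mul_smooth : SmoothOn (A := Q.total.prod Q.total) (fun p => mul p.1 p.2)
    {p | (Q.proj p.1).1 = (Q.proj p.2).2}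
  proj_mul : ∀ v w, (Q.proj v).1 = (Q.proj w).2 →
    Q.proj (mul v w) = ((Q.proj w).1, (Q.proj v).2)
  smul_mul : ∀ (z : ℂˣ) v w, (Q.proj v).1 = (Q.proj w).2 → mul (z • v) w = z • mul v w
  mul_smul : ∀ (z : ℂˣ) v w, (Q.proj v).1 = (Q.proj w).2 → mul v (z • w) = z • mul v w
  mul_assoc : ∀ v w t, (Q.proj v).1 = (Q.proj w).2 → (Q.proj w).1 = (Q.proj t).2 →
    mul (mul v w) t = mul v (mul w t)

namespace BundleGerbe

variable {B : SmoothManifold.{u}} {S : Set B} (G : BundleGerbe B S)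

theorem exists_identity (y : G.Y) :
    ∃ e : G.Q.total, G.Q.proj e = (y, y) ∧ G.mul e e = e := by
  obtain ⟨U, -, hU, s, t, -, hs, -, -⟩ := G.Q.locally_trivial (y, y) rfl
  have h := hs (y, y) ⟨rfl, hU⟩
  have hc : (G.Q.proj (s (y, y))).1 = (G.Q.proj (s (y, y))).2 := by rw [h]
  obtain ⟨z, hz⟩ := G.Q.transitive (s (y, y)) (G.mul (s (y, y)) (s (y, y)))
    (by rw [G.proj_mul _ _ hc, h])
  refine ⟨z⁻¹ • s (y, y), by rw [G.Q.proj_smul, h], ?_⟩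
  have hc' : (G.Q.proj (s (y, y))).1 = (G.Q.proj (z⁻¹ • s (y, y))).2 := by
    rw [G.Q.proj_smul, h]
  rw [G.smul_mul _ _ _ hc', G.mul_smul _ _ _ hc, hz, inv_smul_smul]

/-- The identity section: `e y` is the (unique) idempotent for the product in `Q_{(y, y)}`. -/
noncomputable def e (y : G.Y) : G.Q.total := (G.exists_identity y).choose

end BundleGerbe

/-- A bundle 2-gerbe `(Q, Y, X, M)`. -/
structure BundleTwoGerbe where
  M : SmoothManifold.{u}
  X : SmoothManifold.{u}
  π : X → M
  π_surj : IsSurjectionWithLocalSections π Set.univ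
  /-- The bundle gerbe `(Q, Y, X^{[2]})`. -/
  gerbe : BundleGerbe (X.prod X) {p | π p.1 = π p.2}
  /-- The map `Y_{(x₂, x₃)} × Y_{(x₁, x₂)} → Y_{(x₁, x₃)}` underlying the bundle gerbe morphism
  `π₁⁻¹Q ⊗ π₃⁻¹Q → π₂⁻¹Q` over `X^{[3]}`. -/
  m : gerbe.Y → gerbe.Y → gerbe.Y
  m_smooth : SmoothOn (A := gerbe.Y.prod gerbe.Y) (fun p => m p.1 p.2)
    {p | (gerbe.proj p.1).1 = (gerbe.proj p.2).2}
  proj_m : ∀ y y', (gerbe.proj y).1 = (gerbe.proj y').2 →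
    gerbe.proj (m y y') = ((gerbe.proj y').1, (gerbe.proj y).2)
  /-- The map of `ℂˣ`-bundles
  `Q_{(y₂₃, y₂₃')} ⊗ Q_{(y₁₂, y₁₂')} → Q_{(m(y₂₃, y₁₂), m(y₂₃', y₁₂'))}`,
  as a map defined on pairs and equivariant in each variable. -/
  mHat : gerbe.Q.total → gerbe.Q.total → gerbe.Q.total
  mHat_smooth : SmoothOn (A := gerbe.Q.total.prod gerbe.Q.total) (fun p => mHat p.1 p.2)
    {p | (gerbe.proj (gerbe.Q.proj p.1).1).1 = (gerbe.proj (gerbe.Q.proj p.2).1).2}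
  proj_mHat : ∀ v w, (gerbe.proj (gerbe.Q.proj v).1).1 = (gerbe.proj (gerbe.Q.proj w).1).2 →
    gerbe.Q.proj (mHat v w) =
      (m (gerbe.Q.proj v).1 (gerbe.Q.proj w).1, m (gerbe.Q.proj v).2 (gerbe.Q.proj w).2)
  smul_mHat : ∀ (z : ℂˣ) v w,
    (gerbe.proj (gerbe.Q.proj v).1).1 = (gerbe.proj (gerbe.Q.proj w).1).2 →
    mHat (z • v) w = z • mHat v w
  mHat_smul : ∀ (z : ℂˣ) v w,
    (gerbe.proj (gerbe.Q.proj v).1).1 = (gerbe.proj (gerbe.Q.proj w).1).2 →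
    mHat v (z • w) = z • mHat v w
  /-- The morphism commutes with the bundle gerbe products. -/
  mHat_mul : ∀ v' v w' w,
    (gerbe.Q.proj v').1 = (gerbe.Q.proj v).2 → (gerbe.Q.proj w').1 = (gerbe.Q.proj w).2 →
    (gerbe.proj (gerbe.Q.proj v).1).1 = (gerbe.proj (gerbe.Q.proj w).1).2 →
    mHat (gerbe.mul v' v) (gerbe.mul w' w) = gerbe.mul (mHat v' w') (mHat v w)
  /-- The associator section of `(m₁, m₂)⁻¹Q` over `Y₁₂₃₄`, where `m₁ = m ∘ (m ⊗ 1)` and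
  `m₂ = m ∘ (1 ⊗ m)`. -/
  aHat : gerbe.Y → gerbe.Y → gerbe.Y → gerbe.Q.total
  aHat_smooth : SmoothOn (A := gerbe.Y.prod (gerbe.Y.prod gerbe.Y))
    (fun p => aHat p.1 p.2.1 p.2.2)
    {p | (gerbe.proj p.1).1 = (gerbe.proj p.2.1).2 ∧
      (gerbe.proj p.2.1).1 = (gerbe.proj p.2.2).2}
  proj_aHat : ∀ y₃₄ y₂₃ y₁₂, (gerbe.proj y₃₄).1 = (gerbe.proj y₂₃).2 →
    (gerbe.proj y₂₃).1 = (gerbe.proj y₁₂).2 →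
    gerbe.Q.proj (aHat y₃₄ y₂₃ y₁₂) = (m (m y₃₄ y₂₃) y₁₂, m y₃₄ (m y₂₃ y₁₂))
  /-- Compatibility with the descent isomorphism: the section descends to `X^{[4]}`, that is, it is
  a transformation from `m₁` to `m₂`. -/
  aHat_descent : ∀ v₃₄ v₂₃ v₁₂,
    (gerbe.proj (gerbe.Q.proj v₃₄).1).1 = (gerbe.proj (gerbe.Q.proj v₂₃).1).2 →
    (gerbe.proj (gerbe.Q.proj v₂₃).1).1 = (gerbe.proj (gerbe.Q.proj v₁₂).1).2 →
    gerbe.mul (mHat v₃₄ (mHat v₂₃ v₁₂))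
        (aHat (gerbe.Q.proj v₃₄).1 (gerbe.Q.proj v₂₃).1 (gerbe.Q.proj v₁₂).1) =
      gerbe.mul (aHat (gerbe.Q.proj v₃₄).2 (gerbe.Q.proj v₂₃).2 (gerbe.Q.proj v₁₂).2)
        (mHat (mHat v₃₄ v₂₃) v₁₂)
  /-- The coherency condition over `X^{[5]}`. -/
  aHat_coherence : ∀ y₄₅ y₃₄ y₂₃ y₁₂, (gerbe.proj y₄₅).1 = (gerbe.proj y₃₄).2 →
    (gerbe.proj y₃₄).1 = (gerbe.proj y₂₃).2 → (gerbe.proj y₂₃).1 = (gerbe.proj y₁₂).2 →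
    gerbe.mul (mHat (gerbe.e y₄₅) (aHat y₃₄ y₂₃ y₁₂))
        (gerbe.mul (aHat y₄₅ (m y₃₄ y₂₃) y₁₂) (mHat (aHat y₄₅ y₃₄ y₂₃) (gerbe.e y₁₂))) =
      gerbe.mul (aHat y₄₅ y₃₄ (m y₂₃ y₁₂)) (aHat (m y₄₅ y₃₄) y₂₃ y₁₂)

namespace BundleTwoGerbe

variable (G : BundleTwoGerbe.{u})

/-- The manifold `Y`. -/
abbrev Y : Type u := G.gerbe.Y

/-- The total space `Q`. -/
abbrev Q : Type u := G.gerbe.Q.total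

/-- The projection `Y → X^{[2]}`. -/
abbrev projY (y : G.Y) : G.X × G.X := G.gerbe.proj y

/-- The projection `Q → Y^{[2]}`. -/
abbrev projQ (q : G.Q) : G.Y × G.Y := G.gerbe.Q.proj q

/-- The bundle gerbe product of `Q`. -/
abbrev mul (v w : G.Q) : G.Q := G.gerbe.mul v w

/-- The identity section of `Q`. -/
noncomputable abbrev e (y : G.Y) : G.Q := G.gerbe.e y

/-- The fibre `X_p` of `π : X → M`. -/
def Fibre (p : G.M) : Type u := {x : G.X // G.π x = p}

variable {G} {p : G.M}

/-- A set-theoretic section `I` of `Y → X^{[2]}` over the diagonal of `X_p`. -/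
def IsDiagonalSection (I : G.Fibre p → G.Y) : Prop :=
  ∀ x, G.projY (I x) = (x.1, x.1)

/-- The choices of identity isomorphisms `idL y : y ⇒ m(y, I(x₁))` and `idR y : y ⇒ m(I(x₂), y)`
for `y ∈ Y_{(x₁, x₂)}`, with `x₁, x₂ ∈ X_p`. -/
structure IsIdentityChoice (I : G.Fibre p → G.Y) (idL idR : G.Y → G.Q) : Prop where
  projQ_idL : ∀ (x₁ x₂ : G.Fibre p) (y : G.Y), G.projY y = (x₁.1, x₂.1) →
    G.projQ (idL y) = (y, G.m y (I x₁))
  projQ_idR : ∀ (x₁ x₂ : G.Fibre p) (y : G.Y), G.projY y = (x₁.1, x₂.1) →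
    G.projQ (idR y) = (y, G.m (I x₂) y)
  /-- `idL` descends to a section of a `ℂˣ`-bundle on `X_p × X_p`. -/
  idL_descent : ∀ (x₁ x₂ : G.Fibre p) (q : G.Q), G.projY (G.projQ q).1 = (x₁.1, x₂.1) →
    G.mul (G.mHat q (G.e (I x₁))) (idL (G.projQ q).1) = G.mul (idL (G.projQ q).2) q
  /-- `idR` descends to a section of a `ℂˣ`-bundle on `X_p × X_p`. -/
  idR_descent : ∀ (x₁ x₂ : G.Fibre p) (q : G.Q), G.projY (G.projQ q).1 = (x₁.1, x₂.1) →
    G.mul (G.mHat (G.e (I x₂)) q) (idR (G.projQ q).1) = G.mul (idR (G.projQ q).2) q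
  /-- The two choices agree on the identity 1-arrows. -/
  idL_eq_idR : ∀ x : G.Fibre p, idL (I x) = idR (I x)
  /-- The normalisation that fixes `idR`. -/
  idR_normalised : ∀ (x₁ x₂ : G.Fibre p) (y : G.Y), G.projY y = (x₁.1, x₂.1) →
    G.mul (G.aHat (I x₂) (I x₂) y) (G.mHat (idL (I x₂)) (G.e y)) =
      G.mHat (G.e (I x₂)) (idR y)
  /-- The normalisation that fixes `idL`. -/
  idL_normalised : ∀ (x₁ x₂ : G.Fibre p) (y : G.Y), G.projY y = (x₁.1, x₂.1) →
    G.mul (G.aHat y (I x₁) (I x₁)) (G.mHat (idL y) (G.e (I x₁))) =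
      G.mHat (G.e y) (idR (I x₁))

open scoped CategoryTheory.Bicategory

/-- The bicategory `Q_p`: a bicategory with the points of `X_p` as objects, the points of
`Y_{(x, x')}` as 1-arrows `x ⟶ x'` and the points of `Q_{(y, y')}` as 2-arrows `y ⟶ y'`, and with
the structure prescribed by the bundle 2-gerbe and the choices `I`, `idL`, `idR`.
In Mathlib `f ≫ g` is `g ∘ f`, and the associator and the unitors `α_`, `λ_`, `ρ_` point in the
direction opposite to that of `aHat`, `idL`, `idR`. -/
structure FibreBicategory (I : G.Fibre p → G.Y) (idL idR : G.Y → G.Q) where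
  [bicategory : Bicategory.{u, u} (G.Fibre p)]
  oneArrow : ∀ {x x' : G.Fibre p}, (x ⟶ x') ≃ {y : G.Y // G.projY y = (x.1, x'.1)}
  twoArrow : ∀ {x x' : G.Fibre p} {f g : x ⟶ x'},
    (f ⟶ g) ≃ {q : G.Q // G.projQ q = ((oneArrow f).1, (oneArrow g).1)}
  /-- Composition of 2-arrows is the bundle gerbe product, and its units are given by `e`. -/
  twoArrow_comp : ∀ {x x' : G.Fibre p} {f g h : x ⟶ x'} (η : f ⟶ g) (θ : g ⟶ h),
    (twoArrow (η ≫ θ)).1 = G.mul (twoArrow θ).1 (twoArrow η).1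
  twoArrow_id : ∀ {x x' : G.Fibre p} (f : x ⟶ x'), (twoArrow (𝟙 f)).1 = G.e (oneArrow f).1
  /-- The composition functor is given by `m` on 1-arrows and by `mHat` on 2-arrows. -/
  oneArrow_comp : ∀ {x₁ x₂ x₃ : G.Fibre p} (f : x₁ ⟶ x₂) (g : x₂ ⟶ x₃),
    (oneArrow (f ≫ g)).1 = G.m (oneArrow g).1 (oneArrow f).1
  twoArrow_hcomp : ∀ {x₁ x₂ x₃ : G.Fibre p} {f f' : x₁ ⟶ x₂} {g g' : x₂ ⟶ x₃}
    (η : f ⟶ f') (θ : g ⟶ g'),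
    (twoArrow ((η ▷ g) ≫ (f' ◁ θ))).1 = G.mHat (twoArrow θ).1 (twoArrow η).1
  twoArrow_whiskerLeft : ∀ {x₁ x₂ x₃ : G.Fibre p} (f : x₁ ⟶ x₂) {g g' : x₂ ⟶ x₃} (θ : g ⟶ g'),
    (twoArrow (f ◁ θ)).1 = G.mHat (twoArrow θ).1 (G.e (oneArrow f).1)
  twoArrow_whiskerRight : ∀ {x₁ x₂ x₃ : G.Fibre p} {f f' : x₁ ⟶ x₂} (η : f ⟶ f') (g : x₂ ⟶ x₃),
    (twoArrow (η ▷ g)).1 = G.mHat (G.e (oneArrow g).1) (twoArrow η).1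
  /-- The associativity isomorphism is given by `aHat`. -/
  twoArrow_associator : ∀ {x₁ x₂ x₃ x₄ : G.Fibre p} (f : x₁ ⟶ x₂) (g : x₂ ⟶ x₃) (h : x₃ ⟶ x₄),
    (twoArrow (α_ f g h).inv).1 = G.aHat (oneArrow h).1 (oneArrow g).1 (oneArrow f).1
  /-- The identity 1-arrows are given by `I`, the identity isomorphisms by `idL` and `idR`. -/
  oneArrow_id : ∀ x : G.Fibre p, (oneArrow (𝟙 x)).1 = I x
  twoArrow_leftUnitor : ∀ {x x' : G.Fibre p} (f : x ⟶ x'),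
    (twoArrow (λ_ f).inv).1 = idL (oneArrow f).1
  twoArrow_rightUnitor : ∀ {x x' : G.Fibre p} (f : x ⟶ x'),
    (twoArrow (ρ_ f).inv).1 = idR (oneArrow f).1

end BundleTwoGerbe

/-! Over a fixed `p` only pointwise algebra matters. Each set of 2-arrows `Q_{(y, y')}` is a
nonempty `ℂˣ`-torsor and all products are equivariant, so every 2-arrow is invertible. Moreover,
horizontal composition with a fixed 2-arrow is a bijection between torsors, so equations in which
one factor is unknown have unique solutions.

Choose any `i x : I x ⟶ I x ∘ I x`. The two normalisations, with `i` in place of the unit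
isomorphisms at `I x`, then define `R` and `L` uniquely. As in Kelly's reduction of the coherence
axioms for units, everything else follows by cancelling `I x`: naturality from that of the
associator, `R (I x) = i x` from the pentagon on four copies of `I x` (`right_unit`), hence also `L
(I x) = i x` (`unit_assoc`), and the triangle axiom from the pentagon on `g, I x, I x, f`
(`triangle`). -/

/-! ### Torsor fibres and the units of the bundle gerbe product. -/

namespace CStarBundle

variable {B : SmoothManifold.{u}} {S : Set B} (P : CStarBundle B S)

theorem exists_proj_eq {b : B} (hb : b ∈ S) : ∃ q, P.proj q = b := by
  obtain ⟨U, -, hU, s, t, -, hs, -, -⟩ := P.locally_trivial b hb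
  exact ⟨s b, hs b ⟨hb, hU⟩⟩

theorem smul_left_injective {z w : ℂˣ} {q : P.total} (h : z • q = w • q) : z = w := by
  have := P.free (w⁻¹ * z) q (by rw [mul_smul, h, inv_smul_smul])
  rwa [inv_mul_eq_one, eq_comm] at this

end CStarBundle

namespace BundleGerbe

variable {B : SmoothManifold.{u}} {S : Set B} (G : BundleGerbe B S)

theorem proj_e (y : G.Y) : G.Q.proj (G.e y) = (y, y) := (G.exists_identity y).choose_spec.1

theorem e_mul_e (y : G.Y) : G.mul (G.e y) (G.e y) = G.e y := (G.exists_identity y).choose_spec.2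

/-- Multiplication by `e` acts on `q` through a scalar `z`. Idempotency of `e` and associativity
give `z • z • q = z • q`, so `z = 1` by freeness. -/
theorem e_mul (q : G.Q.total) : G.mul (G.e (G.Q.proj q).2) q = q := by
  set y := (G.Q.proj q).2 with hy
  have hc : (G.Q.proj (G.e y)).1 = (G.Q.proj q).2 := by rw [G.proj_e]
  have he : (G.Q.proj (G.e y)).1 = (G.Q.proj (G.e y)).2 := by rw [G.proj_e]
  obtain ⟨z, hz⟩ := G.Q.transitive q (G.mul (G.e y) q) (by rw [G.proj_mul _ _ hc, G.proj_e])
  have h := G.mul_assoc (G.e y) (G.e y) q he hc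
  rw [G.e_mul_e, hz, G.mul_smul _ _ _ hc, hz] at h
  have h1 : z = 1 := G.Q.free z q ((MulAction.injective z h).symm)
  rw [hz, h1, one_smul]

theorem mul_e (q : G.Q.total) : G.mul q (G.e (G.Q.proj q).1) = q := by
  set y := (G.Q.proj q).1 with hy
  have hc : (G.Q.proj q).1 = (G.Q.proj (G.e y)).2 := by rw [G.proj_e]
  have he : (G.Q.proj (G.e y)).1 = (G.Q.proj (G.e y)).2 := by rw [G.proj_e]
  obtain ⟨z, hz⟩ := G.Q.transitive q (G.mul q (G.e y)) (by rw [G.proj_mul _ _ hc, G.proj_e])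
  have h := G.mul_assoc q (G.e y) (G.e y) hc he
  rw [G.e_mul_e, hz, G.smul_mul _ _ _ hc, hz] at h
  have h1 : z = 1 := G.Q.free z q (MulAction.injective z h)
  rw [hz, h1, one_smul]

end BundleGerbe

/-! ### The groupoids of 1-arrows, with `ℂˣ`-torsors of 2-arrows. -/

namespace BundleTwoGerbe

variable {G : BundleTwoGerbe.{u}} {p : G.M}

/-- The 1-arrows `x ⟶ x'`: the points of the fibre `Y_{(x, x')}`. -/
def OneArrow (x x' : G.Fibre p) : Type u := {y : G.Y // G.projY y = (x.1, x'.1)}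

namespace OneArrow

theorem proj_val {x x' : G.Fibre p} (f : OneArrow x x') : G.gerbe.proj f.1 = (x.1, x'.1) := f.2

/-- The 2-arrows `f ⟶ g`: the points of the fibre `Q_{(f, g)}`. -/
def TwoArrow {x x' : G.Fibre p} (f g : OneArrow x x') : Type u :=
  {q : G.Q // G.projQ q = (f.1, g.1)}

theorem TwoArrow.proj_val {x x' : G.Fibre p} {f g : OneArrow x x'} (η : TwoArrow f g) :
    G.gerbe.Q.proj η.1 = (f.1, g.1) := η.2

/-- The category of 1-arrows `x ⟶ x'`, with the points of `Q_{(y, y')}` as morphisms. -/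
noncomputable instance (x x' : G.Fibre p) : Category.{u} (OneArrow x x') where
  Hom f g := TwoArrow f g
  id f := ⟨G.e f.1, G.gerbe.proj_e f.1⟩
  comp η θ := ⟨G.mul θ.1 η.1, by
    rw [projQ, G.gerbe.proj_mul _ _ (by rw [TwoArrow.proj_val θ, TwoArrow.proj_val η]), TwoArrow.proj_val θ, TwoArrow.proj_val η]⟩
  id_comp {f g} η := Subtype.ext (by
    have := G.gerbe.mul_e η.1
    rwa [TwoArrow.proj_val η] at this)
  comp_id {f g} η := Subtype.ext (by
    have := G.gerbe.e_mul η.1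
    rwa [TwoArrow.proj_val η] at this)
  assoc η θ κ := Subtype.ext
    (G.gerbe.mul_assoc _ _ _ (by rw [TwoArrow.proj_val κ, TwoArrow.proj_val θ]) (by rw [TwoArrow.proj_val θ, TwoArrow.proj_val η])).symm

variable {x x' x₁ x₂ x₃ x₄ x₅ : G.Fibre p}

theorem hom_ext {f g : OneArrow x x'} {η θ : f ⟶ g} (h : η.1 = θ.1) : η = θ := Subtype.ext h

theorem hom_proj {f g : OneArrow x x'} (η : f ⟶ g) : G.gerbe.Q.proj η.1 = (f.1, g.1) := η.2

/-- The scalar action on 2-arrows. -/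
def smulHom (z : ℂˣ) {f g : OneArrow x x'} (η : f ⟶ g) : f ⟶ g :=
  ⟨z • η.1, by rw [projQ, G.gerbe.Q.proj_smul, hom_proj η]⟩

theorem smulHom_smulHom (z w : ℂˣ) {f g : OneArrow x x'} (η : f ⟶ g) :
    smulHom z (smulHom w η) = smulHom (z * w) η := hom_ext (mul_smul z w η.1).symm

theorem one_smulHom {f g : OneArrow x x'} (η : f ⟶ g) : smulHom 1 η = η :=
  hom_ext (one_smul _ η.1)

theorem eq_of_smulHom_eq {z w : ℂˣ} {f g : OneArrow x x'} {η : f ⟶ g}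
    (h : smulHom z η = smulHom w η) : z = w :=
  G.gerbe.Q.smul_left_injective (congrArg Subtype.val h)

theorem exists_smulHom_eq {f g : OneArrow x x'} (η θ : f ⟶ g) : ∃ z, θ = smulHom z η := by
  obtain ⟨z, hz⟩ := G.gerbe.Q.transitive η.1 θ.1 (by rw [hom_proj η, hom_proj θ])
  exact ⟨z, hom_ext hz⟩

theorem comp_smulHom (z : ℂˣ) {f g h : OneArrow x x'} (η : f ⟶ g) (θ : g ⟶ h) :
    η ≫ smulHom z θ = smulHom z (η ≫ θ) :=
  hom_ext (G.gerbe.smul_mul z θ.1 η.1 (by rw [hom_proj θ, hom_proj η]))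

instance (f g : OneArrow x x') : Nonempty (f ⟶ g) := by
  obtain ⟨q, hq⟩ := G.gerbe.Q.exists_proj_eq (b := (f.1, g.1)) (f.2.trans g.2.symm)
  exact ⟨⟨q, hq⟩⟩

theorem exists_comp_eq_id {f g : OneArrow x x'} (η : f ⟶ g) : ∃ θ, η ≫ θ = 𝟙 f := by
  obtain ⟨θ⟩ : Nonempty (g ⟶ f) := inferInstance
  obtain ⟨z, hz⟩ := exists_smulHom_eq (η ≫ θ) (𝟙 f)
  exact ⟨smulHom z θ, by rw [comp_smulHom, hz]⟩

/-- Every 2-arrow has a right inverse, after rescaling an arbitrary 2-arrow backwards. As the right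
inverse has one too, it is two-sided. -/
instance {f g : OneArrow x x'} (η : f ⟶ g) : IsIso η := by
  obtain ⟨θ, hθ⟩ := exists_comp_eq_id η
  obtain ⟨κ, hκ⟩ := exists_comp_eq_id θ
  have h : κ = η := by rw [← Category.id_comp κ, ← hθ, Category.assoc, hκ, Category.comp_id]
  exact ⟨θ, hθ, h ▸ hκ⟩

/-! ### Horizontal composition and the associator. -/

/-- The composition `g ∘ f` of 1-arrows. -/
def circ (g : OneArrow x₂ x₃) (f : OneArrow x₁ x₂) : OneArrow x₁ x₃ :=
  ⟨G.m g.1 f.1, by rw [projY, G.proj_m _ _ (by rw [g.proj_val, f.proj_val]), g.proj_val, f.proj_val]⟩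

theorem composable_of_hom {g g' : OneArrow x₂ x₃} {f f' : OneArrow x₁ x₂}
    (θ : g ⟶ g') (η : f ⟶ f') :
    (G.gerbe.proj (G.gerbe.Q.proj θ.1).1).1 = (G.gerbe.proj (G.gerbe.Q.proj η.1).1).2 := by
  rw [hom_proj θ, hom_proj η, g.proj_val, f.proj_val]

/-- The horizontal composition of 2-arrows. -/
def hcomp {g g' : OneArrow x₂ x₃} {f f' : OneArrow x₁ x₂} (θ : g ⟶ g') (η : f ⟶ f') :
    circ g f ⟶ circ g' f' :=
  ⟨G.mHat θ.1 η.1, by rw [projQ, G.proj_mHat _ _ (composable_of_hom θ η), hom_proj θ, hom_proj η]; rfl⟩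

theorem hcomp_comp_hcomp {g g' g'' : OneArrow x₂ x₃} {f f' f'' : OneArrow x₁ x₂}
    (θ : g ⟶ g') (θ' : g' ⟶ g'') (η : f ⟶ f') (η' : f' ⟶ f'') :
    hcomp θ η ≫ hcomp θ' η' = hcomp (θ ≫ θ') (η ≫ η') :=
  hom_ext (G.mHat_mul θ'.1 θ.1 η'.1 η.1 (by rw [hom_proj θ', hom_proj θ]) (by rw [hom_proj η', hom_proj η])
    (composable_of_hom θ η)).symm

theorem hcomp_comp_hcomp_assoc {g g' g'' : OneArrow x₂ x₃} {f f' f'' : OneArrow x₁ x₂}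
    (θ : g ⟶ g') (θ' : g' ⟶ g'') (η : f ⟶ f') (η' : f' ⟶ f'') {k : OneArrow x₁ x₃}
    (κ : circ g'' f'' ⟶ k) :
    hcomp θ η ≫ hcomp θ' η' ≫ κ = hcomp (θ ≫ θ') (η ≫ η') ≫ κ := by
  rw [← Category.assoc, hcomp_comp_hcomp]

/-- Unit preservation need not be assumed: by interchange the left side is idempotent, and an
idempotent isomorphism is an identity. -/
theorem hcomp_id (g : OneArrow x₂ x₃) (f : OneArrow x₁ x₂) :
    hcomp (𝟙 g) (𝟙 f) = 𝟙 (circ g f) := by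
  rw [← cancel_epi (hcomp (𝟙 g) (𝟙 f)), hcomp_comp_hcomp]
  simp only [Category.comp_id]

theorem hcomp_smulHom (z : ℂˣ) {g g' : OneArrow x₂ x₃} {f f' : OneArrow x₁ x₂} (θ : g ⟶ g')
    (η : f ⟶ f') : hcomp θ (smulHom z η) = smulHom z (hcomp θ η) :=
  hom_ext (G.mHat_smul z _ _ (composable_of_hom θ η))

theorem smulHom_hcomp (z : ℂˣ) {g g' : OneArrow x₂ x₃} {f f' : OneArrow x₁ x₂} (θ : g ⟶ g')
    (η : f ⟶ f') : hcomp (smulHom z θ) η = smulHom z (hcomp θ η) :=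
  hom_ext (G.smul_mHat z _ _ (composable_of_hom θ η))

/-- Two candidates differ by a scalar, which equivariance pulls out and freeness forces to be 1.
This is the cancellation tool for all the unit axioms. -/
theorem hcomp_right_injective {g g' : OneArrow x₂ x₃} {f f' : OneArrow x₁ x₂} (θ : g ⟶ g')
    {η η' : f ⟶ f'} (h : hcomp θ η = hcomp θ η') : η = η' := by
  obtain ⟨z, rfl⟩ := exists_smulHom_eq η η'
  rw [hcomp_smulHom, ← one_smulHom (hcomp θ η), smulHom_smulHom] at h
  rw [← mul_one z, ← eq_of_smulHom_eq h, one_smulHom]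

theorem hcomp_left_injective {g g' : OneArrow x₂ x₃} {f f' : OneArrow x₁ x₂} {θ θ' : g ⟶ g'}
    (η : f ⟶ f') (h : hcomp θ η = hcomp θ' η) : θ = θ' := by
  obtain ⟨z, rfl⟩ := exists_smulHom_eq θ θ'
  rw [smulHom_hcomp, ← one_smulHom (hcomp θ η), smulHom_smulHom] at h
  rw [← mul_one z, ← eq_of_smulHom_eq h, one_smulHom]

/-- Any `η` gives a solution up to a scalar, by transitivity on the target torsor; rescaling `η`
corrects it. -/
theorem exists_hcomp_right_eq {g g' : OneArrow x₂ x₃} {f f' : OneArrow x₁ x₂} (θ : g ⟶ g')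
    (κ : circ g f ⟶ circ g' f') : ∃ η : f ⟶ f', hcomp θ η = κ := by
  obtain ⟨η⟩ : Nonempty (f ⟶ f') := inferInstance
  obtain ⟨z, rfl⟩ := exists_smulHom_eq (hcomp θ η) κ
  exact ⟨smulHom z η, hcomp_smulHom z θ η⟩

theorem exists_hcomp_left_eq {g g' : OneArrow x₂ x₃} {f f' : OneArrow x₁ x₂} (η : f ⟶ f')
    (κ : circ g f ⟶ circ g' f') : ∃ θ : g ⟶ g', hcomp θ η = κ := by
  obtain ⟨θ⟩ : Nonempty (g ⟶ g') := inferInstance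
  obtain ⟨z, rfl⟩ := exists_smulHom_eq (hcomp θ η) κ
  exact ⟨smulHom z θ, smulHom_hcomp z θ η⟩

/-- The associativity 2-arrow `(h ∘ g) ∘ f ⟶ h ∘ (g ∘ f)`. -/
def assoc (h : OneArrow x₃ x₄) (g : OneArrow x₂ x₃) (f : OneArrow x₁ x₂) :
    circ (circ h g) f ⟶ circ h (circ g f) :=
  ⟨G.aHat h.1 g.1 f.1, G.proj_aHat _ _ _ (by rw [h.proj_val, g.proj_val]) (by rw [g.proj_val, f.proj_val])⟩

theorem assoc_naturality {h h' : OneArrow x₃ x₄} {g g' : OneArrow x₂ x₃} {f f' : OneArrow x₁ x₂}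
    (κ : h ⟶ h') (θ : g ⟶ g') (η : f ⟶ f') :
    assoc h g f ≫ hcomp κ (hcomp θ η) = hcomp (hcomp κ θ) η ≫ assoc h' g' f' := by
  have := G.aHat_descent κ.1 θ.1 η.1 (composable_of_hom κ θ) (composable_of_hom θ η)
  rw [hom_proj κ, hom_proj θ, hom_proj η] at this
  exact hom_ext this

theorem pentagon (k : OneArrow x₄ x₅) (h : OneArrow x₃ x₄) (g : OneArrow x₂ x₃)
    (f : OneArrow x₁ x₂) :
    (hcomp (assoc k h g) (𝟙 f) ≫ assoc k (circ h g) f) ≫ hcomp (𝟙 k) (assoc h g f) =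
      assoc (circ k h) g f ≫ assoc k h (circ g f) :=
  hom_ext (G.aHat_coherence k.1 h.1 g.1 f.1 (by rw [k.proj_val, h.proj_val]) (by rw [h.proj_val, g.proj_val])
    (by rw [g.proj_val, f.proj_val]))

/-! ### Coherence of units from the two normalisations. -/

section Units

variable {U : ∀ x : G.Fibre p, OneArrow x x} {i : ∀ x, U x ⟶ circ (U x) (U x)}
  {L : ∀ {x₁ x₂} (f : OneArrow x₁ x₂), f ⟶ circ f (U x₁)}
  {R : ∀ {x₁ x₂} (f : OneArrow x₁ x₂), f ⟶ circ (U x₂) f}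

/-- After composition with `U x₂`, the unitor `R` becomes a composite of `i x₂ ∘ 1` and the
associator, both natural in `f`; then `U x₂` is cancelled. -/
theorem right_naturality
    (hR : ∀ {x₁ x₂} (f : OneArrow x₁ x₂),
      hcomp (i x₂) (𝟙 f) ≫ assoc (U x₂) (U x₂) f = hcomp (𝟙 (U x₂)) (R f))
    {f f' : OneArrow x₁ x₂} (η : f ⟶ f') :
    R f ≫ hcomp (𝟙 (U x₂)) η = η ≫ R f' := by
  apply hcomp_right_injective (𝟙 (U x₂))
  have h1 := hcomp_comp_hcomp (𝟙 (U x₂)) (𝟙 (U x₂)) (R f) (hcomp (𝟙 (U x₂)) η)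
  have h2 := hcomp_comp_hcomp (𝟙 (U x₂)) (𝟙 (U x₂)) η (R f')
  rw [Category.comp_id] at h1 h2
  rw [← h1, ← h2, ← hR, ← hR, Category.assoc, assoc_naturality, hcomp_comp_hcomp_assoc,
    hcomp_comp_hcomp_assoc]
  simp only [hcomp_id, Category.comp_id, Category.id_comp]

theorem left_naturality
    (hL : ∀ {x₁ x₂} (f : OneArrow x₁ x₂),
      hcomp (L f) (𝟙 (U x₁)) ≫ assoc f (U x₁) (U x₁) = hcomp (𝟙 f) (i x₁))
    {f f' : OneArrow x₁ x₂} (η : f ⟶ f') :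
    L f ≫ hcomp η (𝟙 (U x₁)) = η ≫ L f' := by
  apply hcomp_left_injective (𝟙 (U x₁))
  have h1 := hcomp_comp_hcomp (L f) (hcomp η (𝟙 (U x₁))) (𝟙 (U x₁)) (𝟙 (U x₁))
  have h2 := hcomp_comp_hcomp η (L f') (𝟙 (U x₁)) (𝟙 (U x₁))
  rw [Category.comp_id] at h1 h2
  rw [← h1, ← h2, ← cancel_mono (assoc f' (U x₁) (U x₁)), Category.assoc, Category.assoc, hL,
    ← assoc_naturality, ← Category.assoc, hL, hcomp_comp_hcomp, hcomp_comp_hcomp]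
  simp only [hcomp_id, Category.comp_id, Category.id_comp]

/-- Naturality of `R` at the 2-arrow `R f` itself, with the invertible `R f` cancelled. -/
theorem right_circ_unit
    (hR : ∀ {x₁ x₂} (f : OneArrow x₁ x₂),
      hcomp (i x₂) (𝟙 f) ≫ assoc (U x₂) (U x₂) f = hcomp (𝟙 (U x₂)) (R f))
    (f : OneArrow x₁ x₂) : R (circ (U x₂) f) = hcomp (𝟙 (U x₂)) (R f) := by
  rw [← cancel_epi (R f), right_naturality hR (R f)]

theorem right_unit
    (hR : ∀ {x₁ x₂} (f : OneArrow x₁ x₂),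
      hcomp (i x₂) (𝟙 f) ≫ assoc (U x₂) (U x₂) f = hcomp (𝟙 (U x₂)) (R f))
    (x : G.Fibre p) : R (U x) = i x := by
  -- Kelly's identity for the unitor of a composite, here for `U x ∘ U x`: composing with `U x`
  -- reduces it to the pentagon on four copies of `U x`. Comparison with `right_circ_unit` then
  -- identifies `R (U x)` with `i x`.
  have key : R (circ (U x) (U x)) = hcomp (R (U x)) (𝟙 (U x)) ≫ assoc (U x) (U x) (U x) := by
    apply hcomp_right_injective (𝟙 (U x))
    have h1 := hcomp_comp_hcomp (𝟙 (U x)) (𝟙 (U x)) (hcomp (R (U x)) (𝟙 (U x)))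
      (assoc (U x) (U x) (U x))
    have h2 := hcomp_comp_hcomp (hcomp (i x) (𝟙 (U x))) (assoc (U x) (U x) (U x)) (𝟙 (U x))
      (𝟙 (U x))
    rw [Category.comp_id] at h1 h2
    have h3 := assoc_naturality (𝟙 (U x)) (R (U x)) (𝟙 (U x))
    have h4 := assoc_naturality (i x) (𝟙 (U x)) (𝟙 (U x))
    rw [hcomp_id] at h4
    rw [← h1, ← cancel_epi (assoc (U x) (U x) (U x)), ← hR, ← Category.assoc, h4,
      ← Category.assoc, h3, ← hR, ← h2]
    simp only [Category.assoc]
    rw [← pentagon]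
    simp only [Category.assoc]
  rw [right_circ_unit hR, ← hR, cancel_mono] at key
  exact (hcomp_left_injective _ key).symm

/-- No condition on `i` is needed: the solution `R` of the normalisation exists for any `i`, and
`right_unit` makes its value at `U x` equal to `i x`. This reconciles the two normalisations at the
unit. -/
theorem unit_assoc (i : ∀ x, U x ⟶ circ (U x) (U x)) (x : G.Fibre p) :
    hcomp (i x) (𝟙 (U x)) ≫ assoc (U x) (U x) (U x) = hcomp (𝟙 (U x)) (i x) := by
  have hex : ∀ (x₁ x₂ : G.Fibre p) (f : OneArrow x₁ x₂), ∃ r : f ⟶ circ (U x₂) f,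
      hcomp (𝟙 (U x₂)) r = hcomp (i x₂) (𝟙 f) ≫ assoc (U x₂) (U x₂) f :=
    fun x₁ x₂ f => exists_hcomp_right_eq _ _
  choose R hR using hex
  have h := right_unit (R := fun {x₁ x₂} f => R x₁ x₂ f) (fun {x₁ x₂} f => (hR x₁ x₂ f).symm) x
  rw [← hR, h]

theorem triangle
    (hR : ∀ {x₁ x₂} (f : OneArrow x₁ x₂),
      hcomp (i x₂) (𝟙 f) ≫ assoc (U x₂) (U x₂) f = hcomp (𝟙 (U x₂)) (R f))
    (hL : ∀ {x₁ x₂} (f : OneArrow x₁ x₂),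
      hcomp (L f) (𝟙 (U x₁)) ≫ assoc f (U x₁) (U x₁) = hcomp (𝟙 f) (i x₁))
    (g : OneArrow x₂ x₃) (f : OneArrow x₁ x₂) :
    hcomp (L g) (𝟙 f) ≫ assoc g (U x₂) f = hcomp (𝟙 g) (R f) := by
  -- The triangle for `g` and `U x₂ ∘ f`, with `R (U x₂ ∘ f)` written as `1 ∘ R f`. It is the
  -- pentagon on `g, U x₂, U x₂, f`, into which both normalisations are substituted.
  have key : hcomp (L g) (𝟙 (circ (U x₂) f)) ≫ assoc g (U x₂) (circ (U x₂) f) =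
      hcomp (𝟙 g) (hcomp (𝟙 (U x₂)) (R f)) := by
    rw [← cancel_epi (assoc g (U x₂) f), ← hcomp_id, ← Category.assoc, assoc_naturality,
      Category.assoc, ← pentagon, ← hR]
    have h1 := hcomp_comp_hcomp (hcomp (L g) (𝟙 (U x₂))) (assoc g (U x₂) (U x₂)) (𝟙 f) (𝟙 f)
    have h2 := hcomp_comp_hcomp (𝟙 g) (𝟙 g) (hcomp (i x₂) (𝟙 f)) (assoc (U x₂) (U x₂) f)
    rw [Category.comp_id] at h1 h2
    rw [← h2, ← Category.assoc (assoc _ _ _), assoc_naturality, ← hL, ← h1]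
    simp only [Category.assoc]
  -- Naturality along the isomorphism `R f : f ⟶ U x₂ ∘ f` transports the triangle from `U x₂ ∘ f`
  -- back to `f`.
  rw [← cancel_mono (hcomp (𝟙 g) (hcomp (𝟙 (U x₂)) (R f))), Category.assoc, assoc_naturality,
    hcomp_comp_hcomp_assoc, ← key, hcomp_comp_hcomp_assoc]
  simp only [hcomp_id, Category.comp_id, Category.id_comp]

end Units

/-! ### Inverses and the bicategory. -/

theorem hcomp_inv {g g' : OneArrow x₂ x₃} {f f' : OneArrow x₁ x₂} (θ : g ⟶ g') (η : f ⟶ f') :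
    hcomp (inv θ) (inv η) = inv (hcomp θ η) := by
  rw [← cancel_epi (hcomp θ η), hcomp_comp_hcomp]
  simp only [IsIso.hom_inv_id, hcomp_id]

theorem hcomp_id_inv (g : OneArrow x₂ x₃) {f f' : OneArrow x₁ x₂} (η : f ⟶ f') :
    hcomp (𝟙 g) (inv η) = inv (hcomp (𝟙 g) η) := by
  rw [← hcomp_inv, IsIso.inv_id]

theorem hcomp_inv_id {g g' : OneArrow x₂ x₃} (θ : g ⟶ g') (f : OneArrow x₁ x₂) :
    hcomp (inv θ) (𝟙 f) = inv (hcomp θ (𝟙 f)) := by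
  rw [← hcomp_inv, IsIso.inv_id]

/-- The bicategory of points of `X_p`, for given identity 1-arrows and identity isomorphisms. -/
@[reducible]
noncomputable def bicategory (U : ∀ x : G.Fibre p, OneArrow x x)
    (L : ∀ {x₁ x₂} (f : OneArrow x₁ x₂), f ⟶ circ f (U x₁))
    (R : ∀ {x₁ x₂} (f : OneArrow x₁ x₂), f ⟶ circ (U x₂) f)
    (hLn : ∀ {x₁ x₂} {f f' : OneArrow x₁ x₂} (η : f ⟶ f'),
      L f ≫ hcomp η (𝟙 (U x₁)) = η ≫ L f')
    (hRn : ∀ {x₁ x₂} {f f' : OneArrow x₁ x₂} (η : f ⟶ f'),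
      R f ≫ hcomp (𝟙 (U x₂)) η = η ≫ R f')
    (ht : ∀ {x₁ x₂ x₃} (g : OneArrow x₂ x₃) (f : OneArrow x₁ x₂),
      hcomp (L g) (𝟙 f) ≫ assoc g (U x₂) f = hcomp (𝟙 g) (R f)) :
    Bicategory.{u, u} (G.Fibre p) where
  Hom x x' := OneArrow x x'
  id := U
  comp f g := circ g f
  homCategory x x' := inferInstanceAs (Category (OneArrow x x'))
  whiskerLeft f _ _ θ := hcomp θ (𝟙 f)
  whiskerRight η g := hcomp (𝟙 g) η
  associator f g h := (asIso (assoc h g f)).symm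
  leftUnitor f := (asIso (L f)).symm
  rightUnitor f := (asIso (R f)).symm
  whiskerLeft_id f g := hcomp_id g f
  whiskerLeft_comp f _ _ _ η θ := by
    rw [hcomp_comp_hcomp, Category.comp_id]
  id_whiskerLeft η := (IsIso.eq_inv_comp _).2 (hLn η)
  comp_whiskerLeft f g _ _ η := (IsIso.eq_inv_comp _).2 (by
    rw [← hcomp_id]
    exact assoc_naturality η (𝟙 g) (𝟙 f))
  id_whiskerRight f g := hcomp_id g f
  comp_whiskerRight η θ g := by
    rw [hcomp_comp_hcomp, Category.comp_id]
  whiskerRight_id η := (IsIso.eq_inv_comp _).2 (hRn η)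
  whiskerRight_comp η g h := by
    rw [← hcomp_id, ← Category.assoc]
    exact (IsIso.eq_comp_inv _).2 (assoc_naturality (𝟙 h) (𝟙 g) η).symm
  whisker_assoc f _ _ η h := (IsIso.eq_inv_comp _).2 (assoc_naturality (𝟙 h) η (𝟙 f))
  whisker_exchange η θ := by
    rw [hcomp_comp_hcomp, hcomp_comp_hcomp]
    simp only [Category.comp_id, Category.id_comp]
  pentagon f g h k := by
    -- The structural isomorphisms are inverses of `assoc`, `L` and `R`, so the axiom is the inverse
    -- of the coherence condition.
    change hcomp (𝟙 k) (inv (assoc h g f)) ≫ inv (assoc k (circ h g) f) ≫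
      hcomp (inv (assoc k h g)) (𝟙 f) = inv (assoc k h (circ g f)) ≫ inv (assoc (circ k h) g f)
    rw [hcomp_id_inv, hcomp_inv_id]
    simp only [← IsIso.inv_comp]
    rw [IsIso.inv_eq_inv, pentagon]
  triangle {a b c} f g := by
    change inv (assoc g (U b) f) ≫ hcomp (inv (L g)) (𝟙 f) = hcomp (𝟙 g) (inv (R f))
    rw [hcomp_id_inv, hcomp_inv_id, ← IsIso.inv_comp, IsIso.inv_eq_inv, ht]

end OneArrow

open OneArrow

/-! ### Existence of the choices and the conclusion. -/

theorem exists_isDiagonalSection (p : G.M) : ∃ I : G.Fibre p → G.Y, IsDiagonalSection I := by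
  have h : ∀ x : G.Fibre p, ∃ y : G.Y, G.projY y = (x.1, x.1) := fun x => by
    have : (x.1, x.1) ∈ Set.range G.gerbe.proj := by
      rw [G.gerbe.proj_surj.range_eq]
      rfl
    exact this
  choose I hI using h
  exact ⟨I, hI⟩

/-- A choice of 2-arrows for the 1-arrows over `p` extends to a map on all of `Y`. -/
theorem exists_extension {T : ∀ {x₁ x₂ : G.Fibre p}, OneArrow x₁ x₂ → OneArrow x₁ x₂}
    (N : ∀ {x₁ x₂ : G.Fibre p} (f : OneArrow x₁ x₂), f ⟶ T f) :
    ∃ n : G.Y → G.Q, ∀ {x₁ x₂ : G.Fibre p} (f : OneArrow x₁ x₂), n f.1 = (N f).1 := by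
  have h : ∀ y : G.Y, ∃ q : G.Q, ∀ (x₁ x₂ : G.Fibre p) (f : OneArrow x₁ x₂), f.1 = y →
      q = (N f).1 := fun y => by
    by_cases hy : ∃ (x₁ x₂ : G.Fibre p) (f : OneArrow x₁ x₂), f.1 = y
    · obtain ⟨x₁, x₂, f, rfl⟩ := hy
      -- The value does not depend on `f`, since a point of `Y` determines its end points.
      refine ⟨(N f).1, fun x₁' x₂' f' hf => ?_⟩
      have h := f'.proj_val
      rw [hf, f.proj_val, Prod.mk.injEq] at h
      obtain rfl : x₁ = x₁' := Subtype.ext h.1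
      obtain rfl : x₂ = x₂' := Subtype.ext h.2
      obtain rfl : f' = f := Subtype.ext hf
      rfl
    -- An arbitrary value for `y` not lying over `X_p × X_p`.
    · exact ⟨G.e y, fun x₁ x₂ f hf => (hy ⟨x₁, x₂, f, hf⟩).elim⟩
  choose n hn using h
  exact ⟨n, fun f => hn f.1 _ _ f rfl⟩

/-- The second end point of a 2-arrow is over the same points of `X` as the first. -/
theorem projY_snd_eq (q : G.Q) : G.projY (G.projQ q).2 = G.projY (G.projQ q).1 :=
  (G.gerbe.Q.proj_mem q).symm

theorem exists_isIdentityChoice {I : G.Fibre p → G.Y} (hI : IsDiagonalSection I) :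
    ∃ idL idR : G.Y → G.Q, IsIdentityChoice I idL idR := by
  let U : ∀ x : G.Fibre p, OneArrow x x := fun x => ⟨I x, hI x⟩
  -- Any choice works; it determines `R` and `L` through the normalisations.
  let i : ∀ x, U x ⟶ circ (U x) (U x) := fun x => Classical.arbitrary _
  choose R hR' using fun (x₁ x₂ : G.Fibre p) (f : OneArrow x₁ x₂) =>
    exists_hcomp_right_eq (f' := circ (U x₂) f) (𝟙 (U x₂))
      (hcomp (i x₂) (𝟙 f) ≫ assoc (U x₂) (U x₂) f)
  choose L hL' using fun (x₁ x₂ : G.Fibre p) (f : OneArrow x₁ x₂) =>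
    exists_hcomp_left_eq (g' := circ f (U x₁)) (𝟙 (U x₁))
      (hcomp (𝟙 f) (i x₁) ≫ inv (assoc f (U x₁) (U x₁)))
  have hR : ∀ {x₁ x₂} (f : OneArrow x₁ x₂), hcomp (i x₂) (𝟙 f) ≫ assoc (U x₂) (U x₂) f =
      hcomp (𝟙 (U x₂)) (R x₁ x₂ f) := fun f => (hR' _ _ f).symm
  have hL : ∀ {x₁ x₂} (f : OneArrow x₁ x₂),
      hcomp (L x₁ x₂ f) (𝟙 (U x₁)) ≫ assoc f (U x₁) (U x₁) = hcomp (𝟙 f) (i x₁) := fun f => by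
    rw [hL', Category.assoc, IsIso.inv_hom_id, Category.comp_id]
  have hRi : ∀ x, R x x (U x) = i x := right_unit (R := fun {x₁ x₂} f => R x₁ x₂ f) hR
  -- By `unit_assoc`, `i x` also solves the equation that defines `L (U x)`, whose solution is
  -- unique.
  have hLi : ∀ x, L x x (U x) = i x := fun x => by
    apply hcomp_left_injective (𝟙 (U x))
    rw [← cancel_mono (assoc (U x) (U x) (U x)), hL, unit_assoc]
  obtain ⟨idL, hidL⟩ := exists_extension (fun {x₁ x₂} f => L x₁ x₂ f)
  obtain ⟨idR, hidR⟩ := exists_extension (fun {x₁ x₂} f => R x₁ x₂ f)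
  have hLI : ∀ x, idL (I x) = (i x).1 := fun x => by rw [← hLi]; exact hidL (U x)
  have hRI : ∀ x, idR (I x) = (i x).1 := fun x => by rw [← hRi]; exact hidR (U x)
  refine ⟨idL, idR, ⟨fun x₁ x₂ y hy => ?_, fun x₁ x₂ y hy => ?_, fun x₁ x₂ q hq => ?_,
    fun x₁ x₂ q hq => ?_, fun x => (hLI x).trans (hRI x).symm, fun x₁ x₂ y hy => ?_,
    fun x₁ x₂ y hy => ?_⟩⟩
  · rw [hidL (⟨y, hy⟩ : OneArrow x₁ x₂)]
    exact (L x₁ x₂ ⟨y, hy⟩).2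
  · rw [hidR (⟨y, hy⟩ : OneArrow x₁ x₂)]
    exact (R x₁ x₂ ⟨y, hy⟩).2
  · let f : OneArrow x₁ x₂ := ⟨_, hq⟩
    let f' : OneArrow x₁ x₂ := ⟨_, (projY_snd_eq q).trans hq⟩
    let η : f ⟶ f' := ⟨q, rfl⟩
    rw [hidL f, hidL f']
    exact congrArg Subtype.val (left_naturality (L := fun {x₁ x₂} f => L x₁ x₂ f) hL η)
  · let f : OneArrow x₁ x₂ := ⟨_, hq⟩
    let f' : OneArrow x₁ x₂ := ⟨_, (projY_snd_eq q).trans hq⟩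
    let η : f ⟶ f' := ⟨q, rfl⟩
    rw [hidR f, hidR f']
    exact congrArg Subtype.val (right_naturality (R := fun {x₁ x₂} f => R x₁ x₂ f) hR η)
  · rw [hLI, hidR (⟨y, hy⟩ : OneArrow x₁ x₂)]
    exact congrArg Subtype.val (hR ⟨y, hy⟩)
  · rw [hRI, hidL (⟨y, hy⟩ : OneArrow x₁ x₂)]
    exact congrArg Subtype.val (hL ⟨y, hy⟩)

theorem IsIdentityChoice.nonempty_fibreBicategory {I : G.Fibre p → G.Y}
    (hI : IsDiagonalSection I) {idL idR : G.Y → G.Q} (h : IsIdentityChoice I idL idR) :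
    Nonempty (FibreBicategory I idL idR) := by
  let U : ∀ x : G.Fibre p, OneArrow x x := fun x => ⟨I x, hI x⟩
  let L : ∀ {x₁ x₂} (f : OneArrow x₁ x₂), f ⟶ circ f (U x₁) :=
    fun {x₁ x₂} f => ⟨idL f.1, h.projQ_idL x₁ x₂ f.1 f.2⟩
  let R : ∀ {x₁ x₂} (f : OneArrow x₁ x₂), f ⟶ circ (U x₂) f :=
    fun {x₁ x₂} f => ⟨idR f.1, h.projQ_idR x₁ x₂ f.1 f.2⟩
  -- The common value of both unit isomorphisms at `U x` plays the role of `i x` in both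
  -- normalisations.
  have hLR : ∀ x, L (U x) = R (U x) := fun x => hom_ext (h.idL_eq_idR x)
  have hR : ∀ {x₁ x₂} (f : OneArrow x₁ x₂),
      hcomp (L (U x₂)) (𝟙 f) ≫ assoc (U x₂) (U x₂) f = hcomp (𝟙 (U x₂)) (R f) :=
    fun {x₁ x₂} f => hom_ext (h.idR_normalised x₁ x₂ f.1 f.2)
  have hL : ∀ {x₁ x₂} (f : OneArrow x₁ x₂),
      hcomp (L f) (𝟙 (U x₁)) ≫ assoc f (U x₁) (U x₁) = hcomp (𝟙 f) (L (U x₁)) :=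
    fun {x₁ x₂} f => by
      rw [hLR]
      exact hom_ext (h.idL_normalised x₁ x₂ f.1 f.2)
  let _ := OneArrow.bicategory U L R (left_naturality hL) (right_naturality hR) (triangle hR hL)
  exact ⟨{
    oneArrow := Equiv.refl _
    twoArrow := Equiv.refl _
    twoArrow_comp := fun _ _ => rfl
    twoArrow_id := fun _ => rfl
    oneArrow_comp := fun _ _ => rfl
    twoArrow_hcomp := fun {x₁ x₂ x₃ f f' g g'} η θ => congrArg Subtype.val (by
      change hcomp (𝟙 g) η ≫ hcomp θ (𝟙 f') = hcomp θ η
      rw [hcomp_comp_hcomp, Category.id_comp, Category.comp_id])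
    twoArrow_whiskerLeft := fun _ _ _ _ => rfl
    twoArrow_whiskerRight := fun _ _ => rfl
    twoArrow_associator := fun _ _ _ => rfl
    oneArrow_id := fun _ => rfl
    twoArrow_leftUnitor := fun _ => rfl
    twoArrow_rightUnitor := fun _ => rfl }⟩

end BundleTwoGerbe

theorem mainTheorem9 (G : BundleTwoGerbe.{u}) (p : G.M) :
    (∃ I : G.Fibre p → G.Y, BundleTwoGerbe.IsDiagonalSection I) ∧
    ∀ I : G.Fibre p → G.Y, BundleTwoGerbe.IsDiagonalSection I →
      (∃ idL idR : G.Y → G.Q, BundleTwoGerbe.IsIdentityChoice I idL idR) ∧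
      ∀ idL idR : G.Y → G.Q, BundleTwoGerbe.IsIdentityChoice I idL idR →
        Nonempty (BundleTwoGerbe.FibreBicategory I idL idR) :=
  ⟨BundleTwoGerbe.exists_isDiagonalSection p, fun _ hI =>
    ⟨BundleTwoGerbe.exists_isIdentityChoice hI, fun _ _ h => h.nonempty_fibreBicategory hI⟩⟩
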